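/- Let $\mathbb{D}$ be the open unit disk, $\mathbb{T}=\partial\mathbb{D}$ with normalized arc length measure $m$, and let $b$ be an analytic function on $\mathbb{D}$ with $|b|\le 1$ (that is, $b$ lies in the closed unit ball of $H^\infty$). Let $\mathscr{H}(b)$ be the de Branges–Rovnyak space, that is, the Hilbert space of functions on $\mathbb{D}$ with reproducing kernel $$k^b_\lambda(z)=\frac{1-\overline{b(\lambda)}\,b(z)}{1-\overline{\lambda}z},\qquad \lambda,z\in\mathbb{D}.$$ Call $b$ inner if, for $m$-almost every $\zeta\in\mathbb{T}$, $b$ has a non-tangential limit of modulus $1$ at $\zeta$. Call a sequence $(\lambda_n)_{n\ge1}\subset\mathbb{D}$ a sampling sequence for $\mathscr{H}(b)$ if there are constants $c,C>0$ such that $$c\,\|f\|_b^2\le\sum_{n=1}^\infty \|k^b_{\lambda_n}\|_b^{-2}\,|f(\lambda_n)|^2\le C\,\|f\|_b^2\qquad\text{for all } f\in\mathscr{H}(b).$$ (a) If $\mathscr{H}(b)$ admits a sampling sequence, then $b$ is an inner function. (b) If $b$ is not inner, then $\mathscr{H}(b)$ has no orthogonal basis consisting of reproducing kernels: there is no set $\Lambda\subset\mathbb{D}$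 for which $\{k^b_\lambda:\lambda\in\Lambda\}$ is a family of nonzero, pairwise orthogonal vectors with dense linear span in $\mathscr{H}(b)$. -/

import Mathlib

open Complex MeasureTheory Filter Topology
open scoped ComplexConjugate Complex.UnitDisc

noncomputable section

/-- The closed unit ball of `H^∞`: analytic functions on the open unit disk bounded by `1`.
Only the values of `toFun` on the open unit disk matter. -/
structure HInftyUnitBall where
  toFun : ℂ → ℂ
  differentiableOn : DifferentiableOn ℂ toFun (Metric.ball 0 1)
  norm_le_one : ∀ z ∈ Metric.ball (0 : ℂ) 1, ‖toFun z‖ ≤ 1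

/-- The non-tangential approach region (Stolz angle) of aperture `M` at the point `ζ` of the unit
circle. It is empty unless `1 < M`. -/
def stolzAngle (ζ : ℂ) (M : ℝ) : Set ℂ :=
  {z | ‖z‖ < 1 ∧ ‖z - ζ‖ < M * (1 - ‖z‖)}

/-- `f` has non-tangential limit `w` at the point `ζ` of the unit circle. -/
def HasNontangentialLimit (f : ℂ → ℂ) (ζ w : ℂ) : Prop :=
  ∀ M : ℝ, Tendsto f (𝓝[stolzAngle ζ M] ζ) (𝓝 w)

/-- `b` is inner: at almost every point `e^{iθ}` of the unit circle it has a non-tangential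
boundary value of modulus `1`. (Arc length null sets of the circle correspond to Lebesgue null
sets of angles `θ`.) -/
def HInftyUnitBall.IsInner (b : HInftyUnitBall) : Prop :=
  ∀ᵐ θ : ℝ, ∃ w : ℂ, HasNontangentialLimit b.toFun (Complex.exp (θ * Complex.I)) w ∧ ‖w‖ = 1

/-- The scalar kernel `k^b_lam(z) = (1 - conj (b lam) * b z) / (1 - conj lam * z)`. -/
def dbrKernelFun (b : HInftyUnitBall) (lam z : 𝔻) : ℂ :=
  (1 - conj (b.toFun lam) * b.toFun z) / (1 - conj (lam : ℂ) * z)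

/-- The kernel `k^b`, as a matrix of operators on `ℂ`; the `(z, lam)` entry is multiplication by
`k^b_lam(z)`. -/
def dbrKernel (b : HInftyUnitBall) : Matrix 𝔻 𝔻 (ℂ →L[ℂ] ℂ) :=
  .of fun z lam => dbrKernelFun b lam z • ContinuousLinearMap.id ℂ ℂ

/-- Positivity of the kernel for a function `B` that is continuous up to the boundary. -/
theorem dbrKernel_pos_aux {B : ℂ → ℂ} (hB : DiffContOnCl ℂ B (Metric.ball 0 1))
    (hB1 : ∀ z ∈ Metric.sphere (0 : ℂ) 1, ‖B z‖ ≤ 1) (s : Finset 𝔻) (c : 𝔻 → ℂ) :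
    0 ≤ (∑ i ∈ s, ∑ j ∈ s, conj (c i) * c j *
      ((1 - conj (B j) * B i) / (1 - conj (j : ℂ) * i))).re := by
  have hden : ∀ (j : 𝔻) (z : ℂ), z ∈ Metric.closedBall (0 : ℂ) 1 → 1 - conj (j : ℂ) * z ≠ 0 := by
    intro j z hz h
    have h1 : ‖conj (j : ℂ) * z‖ < 1 := by
      rw [norm_mul, RCLike.norm_conj]
      have := j.norm_lt_one
      have hz' : ‖z‖ ≤ 1 := by simpa using hz
      nlinarith [norm_nonneg z, norm_nonneg (j : ℂ)]
    rw [← sub_eq_zero.1 h] at h1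
    simp at h1
  have hcl : closure (Metric.ball (0 : ℂ) 1) = Metric.closedBall 0 1 :=
    closure_ball _ one_ne_zero
  have hk : ∀ j : 𝔻, DiffContOnCl ℂ (fun z => (1 - conj (j : ℂ) * z)⁻¹) (Metric.ball 0 1) := by
    intro j
    apply DifferentiableOn.diffContOnCl
    rw [hcl]
    intro z hz
    have hd : DifferentiableAt ℂ (fun z : ℂ => 1 - conj (j : ℂ) * z) z := by fun_prop
    exact (hd.inv (hden j z hz)).differentiableWithinAt
  have key : ∀ (F : ℂ → ℂ), DiffContOnCl ℂ F (Metric.ball 0 1) → ∀ i : 𝔻,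
      CircleIntegrable (fun z => F z * conj ((1 - conj (i : ℂ) * z)⁻¹)) 0 1 ∧
      Real.circleAverage (fun z => F z * conj ((1 - conj (i : ℂ) * z)⁻¹)) 0 1 = F i := by
    intro F hF i
    constructor
    · apply ContinuousOn.circleIntegrable zero_le_one
      have hs : Metric.sphere (0 : ℂ) 1 ⊆ closure (Metric.ball 0 1) := by
        rw [hcl]; exact Metric.sphere_subset_closedBall
      exact (hF.continuousOn.mono hs).mul
        (Complex.continuous_conj.comp_continuousOn ((hk i).continuousOn.mono hs))
    · have h := DiffContOnCl.circleAverage_smul_div (c := 0) (R := 1) (w := (i : ℂ)) (f := F)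
        (by simpa using hF) (by simpa using i.norm_lt_one)
      rw [← h]
      apply Real.circleAverage_congr_sphere
      intro z hz
      have hz1 : ‖z‖ = 1 := by simpa using hz
      have hz0 : z ≠ 0 := by rintro rfl; simp at hz1
      have hzz : conj z = z⁻¹ := by
        rw [Complex.inv_def, Complex.normSq_eq_norm_sq, hz1]; simp
      have hzi : z - i ≠ 0 := by
        intro h0
        have := i.norm_lt_one
        rw [← sub_eq_zero.1 h0, hz1] at this
        exact lt_irrefl _ this
      have : 1 - (i : ℂ) * z⁻¹ ≠ 0 := by
        intro h0; apply hzi; field_simp at h0; simpa using h0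
      simp only [map_inv₀, map_sub, map_one, map_mul, Complex.conj_conj, hzz, smul_eq_mul, sub_zero]
      field_simp
  set k : 𝔻 → ℂ → ℂ := fun j z => (1 - conj (j : ℂ) * z)⁻¹ with hkdef
  have hkc : ∀ (a : 𝔻 → ℂ), DiffContOnCl ℂ (fun z => ∑ j ∈ s, a j * k j z) (Metric.ball 0 1) := by
    intro a
    refine ⟨?_, ?_⟩
    · exact DifferentiableOn.fun_sum fun j _ => (hk j).differentiableOn.const_mul (a j)
    · exact continuousOn_finsetSum _ fun j _ => continuousOn_const.mul (hk j).continuousOn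
  set g : ℂ → ℂ := fun z => ∑ j ∈ s, c j * k j z with hg
  set h : ℂ → ℂ := fun z => ∑ j ∈ s, (c j * conj (B j)) * k j z with hh
  have hgd : DiffContOnCl ℂ g (Metric.ball 0 1) := hkc _
  have hhd : DiffContOnCl ℂ h (Metric.ball 0 1) := hkc _
  have hBh : DiffContOnCl ℂ (fun z => B z * h z) (Metric.ball 0 1) := by
    simpa [smul_eq_mul] using hB.smul hhd
  have pair : ∀ (F : ℂ → ℂ), DiffContOnCl ℂ F (Metric.ball 0 1) → ∀ a : 𝔻 → ℂ,
      CircleIntegrable (fun z => F z * conj (∑ j ∈ s, a j * k j z)) 0 1 ∧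
      Real.circleAverage (fun z => F z * conj (∑ j ∈ s, a j * k j z)) 0 1
        = ∑ i ∈ s, conj (a i) * F i := by
    intro F hF a
    have e : (fun z => F z * conj (∑ j ∈ s, a j * k j z))
        = fun z => ∑ i ∈ s, conj (a i) • (F z * conj (k i z)) := by
      funext z
      rw [map_sum, Finset.mul_sum]
      refine Finset.sum_congr rfl fun i _ => ?_
      rw [map_mul, smul_eq_mul]; ring
    have hint : ∀ i ∈ s, CircleIntegrable (fun z => conj (a i) • (F z * conj (k i z))) 0 1 :=
      fun i _ => ((key F hF i).1).const_fun_smul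
    rw [e]
    refine ⟨CircleIntegrable.fun_sum s hint, ?_⟩
    rw [Real.circleAverage_fun_sum hint]
    refine Finset.sum_congr rfl fun i _ => ?_
    rw [Real.circleAverage_fun_smul, (key F hF i).2, smul_eq_mul]
  obtain ⟨i1, a1⟩ := pair g hgd c
  obtain ⟨i2, a2⟩ := pair h hhd (fun j => c j * conj (B j))
  obtain ⟨i3, a3⟩ := pair _ hBh c
  have i12 : CircleIntegrable (fun z => g z * conj (g z) + h z * conj (h z)) 0 1 := i1.add i2
  have i3' : CircleIntegrable (fun z => (2 : ℂ) • (B z * h z * conj (g z))) 0 1 :=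
    i3.const_fun_smul
  have tot : Real.circleAverage (fun z => (g z * conj (g z) + h z * conj (h z))
      - (2 : ℂ) • (B z * h z * conj (g z))) 0 1
      = ∑ i ∈ s, ∑ j ∈ s, conj (c i) * c j *
        ((1 - conj (B j) * B i) / (1 - conj (j : ℂ) * i)) := by
    rw [Real.circleAverage_fun_sub i12 i3', Real.circleAverage_fun_add i1 i2,
      Real.circleAverage_fun_smul, a1, a2, a3, smul_eq_mul, Finset.mul_sum,
      ← Finset.sum_add_distrib, ← Finset.sum_sub_distrib]
    refine Finset.sum_congr rfl fun i _ => ?_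
    simp only [hg, hh, hkdef, Finset.mul_sum, map_mul, Complex.conj_conj]
    rw [← Finset.sum_add_distrib, ← Finset.sum_sub_distrib]
    refine Finset.sum_congr rfl fun j _ => ?_
    rw [div_eq_mul_inv]; ring
  rw [← tot]
  have hre := Complex.reCLM.circleAverage_comp_comm (i12.sub i3')
  have hre' : (Real.circleAverage (fun z => (g z * conj (g z) + h z * conj (h z))
      - (2 : ℂ) • (B z * h z * conj (g z))) 0 1).re = _ := hre.symm
  rw [hre']
  apply Real.circleAverage_nonneg_of_nonneg
  intro z hz
  have hz1 : ‖B z‖ ≤ 1 := hB1 z (by simpa using hz)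
  have hsq : Complex.normSq (B z) ≤ 1 := by
    rw [Complex.normSq_eq_norm_sq]; nlinarith [norm_nonneg (B z)]
  change 0 ≤ ((g z * conj (g z) + h z * conj (h z)) - (2 : ℂ) * (B z * h z * conj (g z))).re
  have e : ((g z * conj (g z) + h z * conj (h z)) - (2 : ℂ) * (B z * h z * conj (g z))).re
      = Complex.normSq (g z - B z * h z)
        + (1 - Complex.normSq (B z)) * Complex.normSq (h z) := by
    simp [Complex.normSq_apply]; ring
  rw [e]
  have := Complex.normSq_nonneg (g z - B z * h z)
  have := mul_nonneg (sub_nonneg.2 hsq) (Complex.normSq_nonneg (h z))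
  linarith

theorem dbrKernel_pos (b : HInftyUnitBall) (s : Finset 𝔻) (c : 𝔻 → ℂ) :
    0 ≤ (∑ i ∈ s, ∑ j ∈ s, conj (c i) * c j * dbrKernelFun b j i).re := by
  have hdil : ∀ r ∈ Set.Ioo (0 : ℝ) 1, ∀ z ∈ Metric.closedBall (0 : ℂ) 1,
      (r : ℂ) * z ∈ Metric.ball (0 : ℂ) 1 := by
    intro r hr z hz
    have hz' : ‖z‖ ≤ 1 := by simpa using hz
    have : ‖(r : ℂ) * z‖ < 1 := by
      rw [norm_mul, Complex.norm_real, Real.norm_of_nonneg hr.1.le]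
      nlinarith [hr.1, hr.2, norm_nonneg z]
    simpa using this
  have hr : ∀ r ∈ Set.Ioo (0 : ℝ) 1, 0 ≤ (∑ i ∈ s, ∑ j ∈ s, conj (c i) * c j *
      ((1 - conj (b.toFun (r * j)) * b.toFun (r * i)) / (1 - conj (j : ℂ) * i))).re := by
    intro r hr
    refine dbrKernel_pos_aux (B := fun z => b.toFun (r * z)) ?_ ?_ s c
    · apply DifferentiableOn.diffContOnCl
      rw [closure_ball _ one_ne_zero]
      exact b.differentiableOn.comp (differentiableOn_id.const_mul (r : ℂ)) (hdil r hr)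
    · intro z hz
      exact b.norm_le_one _ (hdil r hr z (Metric.sphere_subset_closedBall hz))
  have hb : ∀ i : 𝔻, Tendsto (fun r : ℝ => b.toFun (r * i)) (𝓝[<] 1) (𝓝 (b.toFun i)) := by
    intro i
    have hi : (i : ℂ) ∈ Metric.ball (0 : ℂ) 1 := by simpa using i.norm_lt_one
    have hc : ContinuousAt b.toFun (i : ℂ) :=
      (b.differentiableOn.differentiableAt (Metric.isOpen_ball.mem_nhds hi)).continuousAt
    have ht : Tendsto (fun r : ℝ => (r : ℂ) * (i : ℂ)) (𝓝[<] 1) (𝓝 (i : ℂ)) := by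
      have : Continuous fun r : ℝ => (r : ℂ) * (i : ℂ) := by fun_prop
      have h := this.tendsto 1
      simp only [Complex.ofReal_one, one_mul] at h
      exact h.mono_left nhdsWithin_le_nhds
    exact hc.tendsto.comp ht
  have hlim : Tendsto (fun r : ℝ => (∑ i ∈ s, ∑ j ∈ s, conj (c i) * c j *
      ((1 - conj (b.toFun (r * j)) * b.toFun (r * i)) / (1 - conj (j : ℂ) * i))).re) (𝓝[<] 1)
      (𝓝 (∑ i ∈ s, ∑ j ∈ s, conj (c i) * c j * dbrKernelFun b j i).re) := by
    refine (Complex.continuous_re.tendsto _).comp (tendsto_finsetSum _ fun i _ =>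
      tendsto_finsetSum _ fun j _ => Tendsto.const_mul _ (Tendsto.div_const
        (Tendsto.const_sub _ (Tendsto.mul ?_ (hb i))) _))
    exact (Complex.continuous_conj.tendsto _).comp (hb j)
  refine ge_of_tendsto hlim ?_
  filter_upwards [Ioo_mem_nhdsLT (zero_lt_one (α := ℝ))] with r hr'
  exact hr r hr'

/-- The kernel `k^b` is positive semidefinite. -/
instance fact_dbrKernel_posSemidef (b : HInftyUnitBall) : Fact (dbrKernel b).PosSemidef := by
  have hiff := (RKHS.posSemidef_tfae (K := dbrKernel b)).out 0 2
  refine ⟨hiff.2 ⟨?_, ?_⟩⟩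
  · ext z lam
    refine ext_inner_right ℂ fun w => ?_
    simp only [Matrix.conjTranspose_apply, ContinuousLinearMap.star_eq_adjoint,
      ContinuousLinearMap.adjoint_inner_left]
    simp [dbrKernel, dbrKernelFun, mul_comm]
  · intro vv
    have := dbrKernel_pos b vv.support (fun i => vv i)
    rw [← Complex.conj_re] at this
    have e : (vv.sum fun x w => vv.sum fun x' w' => inner ℂ ((dbrKernel b x' x) w) w')
        = conj (∑ i ∈ vv.support, ∑ j ∈ vv.support,
          conj (vv i) * vv j * dbrKernelFun b j i) := by
      simp only [Finsupp.sum, map_sum]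
      rw [Finset.sum_comm]
      refine Finset.sum_congr rfl fun i _ => Finset.sum_congr rfl fun j _ => ?_
      simp [dbrKernel]
      ring
    rw [e]
    exact this

/-- The de Branges-Rovnyak space `H(b)`: the Hilbert space of functions on the open unit disk with
reproducing kernel `k^b`. -/
abbrev DeBrangesRovnyak (b : HInftyUnitBall) : Type :=
  RKHS.OfKernel (dbrKernel b)

section RKHS

variable {X : Type*} (H : Type*) [NormedAddCommGroup H] [InnerProductSpace ℂ H] [CompleteSpace H]
  [RKHS ℂ H X ℂ]

/-- The reproducing kernel function of `H` at the point `x`: `⟪reproducingKernel H x, f⟫ = f x`. -/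
def reproducingKernel (x : X) : H := RKHS.kerFun H x 1

/-- `(x n)` is a sampling sequence for `H`:
`‖f‖² ≍ ∑ₙ ‖k_{x n}‖⁻² |f (x n)|²` for all `f ∈ H`, with constants independent of `f`. -/
def IsSamplingSequence (x : ℕ → X) : Prop :=
  ∃ c C : ℝ, 0 < c ∧ 0 < C ∧ ∀ f : H,
    Summable (fun n => (‖reproducingKernel H (x n)‖ ^ 2)⁻¹ * ‖f (x n)‖ ^ 2) ∧
    c * ‖f‖ ^ 2 ≤ ∑' n, (‖reproducingKernel H (x n)‖ ^ 2)⁻¹ * ‖f (x n)‖ ^ 2 ∧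
    ∑' n, (‖reproducingKernel H (x n)‖ ^ 2)⁻¹ * ‖f (x n)‖ ^ 2 ≤ C * ‖f‖ ^ 2

/-- The reproducing kernels at the points of `S` form an orthogonal basis of `H`: they are nonzero,
pairwise orthogonal, and their linear span is dense. -/
def IsOrthogonalKernelBasis (S : Set X) : Prop :=
  (∀ x ∈ S, reproducingKernel H x ≠ 0) ∧
  (∀ x ∈ S, ∀ y ∈ S, x ≠ y → inner ℂ (reproducingKernel H x) (reproducingKernel H y) = 0) ∧
  (Submodule.span ℂ (reproducingKernel H '' S)).topologicalClosure = ⊤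

end RKHS

end

/-! Both parts rest on a lower frame bound `c ‖f‖² ≤ ∑ w_i |f(x_i)|²`, where `w_i = ‖k_{x_i}‖⁻²` and
the sums converge; for an orthogonal basis of kernels Parseval gives it with `c = 1`. The case where
`|b| = 1` somewhere in the disk is trivial, since `b` is then a unimodular constant.

Otherwise, test the bound on `f = k_λ` with `λ = r e^{iθ}`. As `‖k_λ‖² = (1 - |b(λ)|²) / (1 - r²)`
and `|k_λ(x_i)|² ≤ 4 / |e^{iθ} - r x_i|²`, the right side is a sum of multiples of Poisson kernels
at `r x_i`. Integrating in `θ` bounds the mean of `1 - |b|²` on the circle of radius `r` by `(4/c) ∑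
w_i (1 - r²) / (1 - r²|x_i|²)`. Testing on `k_0` shows `∑ w_i < ∞`, so dominated convergence sends
this to `0` as `r → 1`. Fatou's lemma, together with the existence of boundary values, then forces
`|b| = 1` almost everywhere on the circle (`HInftyUnitBall.isInner_of_tendsto_lintegral`).

Boundary values come from Fatou's theorem, deduced from one-variable differentiation: a primitive of
a bounded `f` is Lipschitz, hence differentiable along the circle almost everywhere, and at such
points a Poisson-type formula for the derivative (`circleAverage_poissonKernel_eq_deriv`) yields the
non-tangential limit of `f`. -/

/-! ### Poisson averages and derivatives -/

theorem one_sub_conj_mul_ne_zero {z w : ℂ} (hz : ‖z‖ < 1) (hw : ‖w‖ ≤ 1) :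
    1 - conj z * w ≠ 0 := by
  intro h
  have h1 : ‖conj z * w‖ < 1 := by
    rw [norm_mul, RCLike.norm_conj]
    nlinarith [norm_nonneg z, norm_nonneg w]
  rw [← sub_eq_zero.1 h] at h1
  simp at h1

theorem norm_one_sub_conj_mul {z w : ℂ} (hw : ‖w‖ = 1) : ‖1 - conj z * w‖ = ‖w - z‖ := by
  have hww : conj w * w = 1 := by
    rw [mul_comm, mul_conj, normSq_eq_norm_sq, hw]; simp
  have : 1 - conj z * w = conj (w - z) * w := by
    rw [map_sub, sub_mul, hww]
  rw [this, norm_mul, RCLike.norm_conj, hw, mul_one]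

theorem sub_ne_zero_of_norm {z w : ℂ} (hz : ‖z‖ < 1) (hw : ‖w‖ = 1) : w - z ≠ 0 := by
  rw [sub_ne_zero]; rintro rfl; linarith

theorem poissonKernel_zero_of_norm {z w : ℂ} (hw : ‖w‖ = 1) :
    poissonKernel 0 z w = (1 - ‖z‖ ^ 2) / ‖w - z‖ ^ 2 := by
  simp [poissonKernel_def, hw]

theorem poissonKernel_zero_nonneg {z w : ℂ} (hz : ‖z‖ < 1) (hw : ‖w‖ = 1) :
    0 ≤ poissonKernel 0 z w := by
  rw [poissonKernel_zero_of_norm hw]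
  have : ‖z‖ ^ 2 ≤ 1 := by nlinarith [norm_nonneg z]
  exact div_nonneg (by linarith) (by positivity)

theorem continuousOn_poissonKernel_zero {z : ℂ} (hz : ‖z‖ < 1) :
    ContinuousOn (poissonKernel 0 z) (Metric.sphere 0 1) := by
  have : ContinuousOn (fun w : ℂ => (1 - ‖z‖ ^ 2) / ‖w - z‖ ^ 2) (Metric.sphere 0 1) := by
    refine ContinuousOn.div (by fun_prop) (by fun_prop) fun w hw => ?_
    have := sub_ne_zero_of_norm hz (by simpa using hw)
    positivity
  exact this.congr fun w hw => poissonKernel_zero_of_norm (by simpa using hw)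

theorem circleAverage_poissonKernel_zero {z : ℂ} (hz : ‖z‖ < 1) :
    Real.circleAverage (poissonKernel 0 z) 0 1 = 1 := by
  have h := DiffContOnCl.circleAverage_poissonKernel_smul (c := 0) (R := 1) (w := z)
    (f := fun _ => (1 : ℂ)) diffContOnCl_const (by simpa using hz)
  have h2 := Complex.reCLM.circleAverage_comp_comm (c := 0) (R := 1)
    (f := poissonKernel 0 z • fun _ => (1 : ℂ)) (by
      apply ContinuousOn.circleIntegrable zero_le_one
      exact (continuousOn_poissonKernel_zero hz).smul continuousOn_const)
  rw [h] at h2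
  simpa [Function.comp_def] using h2

theorem norm_circleAverage_le {f : ℂ → ℂ} :
    ‖Real.circleAverage f 0 1‖ ≤ Real.circleAverage (fun z => ‖f z‖) 0 1 := by
  rw [Real.circleAverage_def, Real.circleAverage_def, norm_smul, smul_eq_mul,
    Real.norm_of_nonneg (by positivity)]
  gcongr
  exact intervalIntegral.norm_integral_le_integral_norm (by positivity)

theorem DiffContOnCl.dslope_unit_ball {G : ℂ → ℂ} (hG : DiffContOnCl ℂ G (Metric.ball 0 1)) {z : ℂ}
    (hz : ‖z‖ < 1) : DiffContOnCl ℂ (dslope G z) (Metric.ball 0 1) := by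
  have hzb : Metric.ball (0 : ℂ) 1 ∈ 𝓝 z := Metric.isOpen_ball.mem_nhds (by simpa using hz)
  have hd : DifferentiableAt ℂ G z := hG.differentiableOn.differentiableAt hzb
  exact ⟨(differentiableOn_dslope hzb).2 hG.differentiableOn,
    (continuousOn_dslope (mem_of_superset hzb subset_closure)).2 ⟨hG.continuousOn, hd⟩⟩

theorem diffContOnCl_inv_one_sub {z : ℂ} (hz : ‖z‖ < 1) :
    DiffContOnCl ℂ (fun w => (1 - conj z * w)⁻¹) (Metric.ball 0 1) := by
  apply DifferentiableOn.diffContOnCl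
  rw [closure_ball _ one_ne_zero]
  intro w hw
  have hd : DifferentiableAt ℂ (fun w : ℂ => 1 - conj z * w) w := by fun_prop
  exact (hd.inv (one_sub_conj_mul_ne_zero hz (by simpa using hw))).differentiableWithinAt

/-- On the circle `1/(w - z)` is the conjugate of `w / (1 - z̄ w)`, which is analytic in the disk
and so is reproduced by the Poisson kernel. -/
theorem circleAverage_poissonKernel_mul_inv_sub {z : ℂ} (hz : ‖z‖ < 1) :
    Real.circleAverage (fun w => (poissonKernel 0 z w : ℂ) * (w - z)⁻¹) 0 1
      = conj z * (1 - conj z * z)⁻¹ := by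
  have hd : DiffContOnCl ℂ (fun w => w * (1 - conj z * w)⁻¹) (Metric.ball 0 1) := by
    simpa [smul_eq_mul] using (differentiable_id (𝕜 := ℂ)).diffContOnCl.smul (diffContOnCl_inv_one_sub hz)
  have h := hd.circleAverage_poissonKernel_smul (w := z) (by simpa using hz)
  have hint : CircleIntegrable (poissonKernel 0 z • fun w => w * (1 - conj z * w)⁻¹) 0 1 := by
    apply ContinuousOn.circleIntegrable zero_le_one
    refine (continuousOn_poissonKernel_zero hz).smul (hd.continuousOn.mono ?_)
    rw [closure_ball _ one_ne_zero]; exact Metric.sphere_subset_closedBall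
  have h2 := (Complex.conjCLE : ℂ →L[ℝ] ℂ).circleAverage_comp_comm hint
  rw [h] at h2
  have e : ∀ x : ℂ, (Complex.conjCLE : ℂ →L[ℝ] ℂ) x = conj x := fun _ => rfl
  rw [e] at h2
  have e2 : conj (z * (1 - conj z * z)⁻¹) = conj z * (1 - conj z * z)⁻¹ := by
    simp [mul_comm]
  rw [← e2, ← h2]
  apply Real.circleAverage_congr_sphere
  intro w hw
  have hw1 : ‖w‖ = 1 := by simpa using hw
  have hww : conj w * w = 1 := by
    rw [mul_comm, mul_conj, normSq_eq_norm_sq, hw1]; simp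
  have h1 := sub_ne_zero_of_norm hz hw1
  have h3 : 1 - z * conj w ≠ 0 := by
    have := (map_ne_zero (starRingEnd ℂ)).2 (one_sub_conj_mul_ne_zero hz hw1.le)
    simpa using this
  have h4 : (w - z)⁻¹ = conj w * (1 - z * conj w)⁻¹ := by
    field_simp
    linear_combination -hww
  simp only [Function.comp_apply, Pi.smul_apply', e]
  simp [h4]

/-- A formula for the derivative of an analytic function on the disk whose kernel decays like
`(1 - |z|) / |w - z| ^ 3`. -/
theorem circleAverage_poissonKernel_eq_deriv {G : ℂ → ℂ}
    (hG : DiffContOnCl ℂ G (Metric.ball 0 1)) {z : ℂ} (hz : ‖z‖ < 1) :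
    Real.circleAverage (fun w => (poissonKernel 0 z w : ℂ) *
      (G w * ((w - z)⁻¹ - conj z * (1 - conj z * w)⁻¹))) 0 1 = deriv G z := by
  have hzb : z ∈ Metric.ball (0 : ℂ) 1 := by simpa using hz
  have hs : Metric.sphere (0 : ℂ) 1 ⊆ closure (Metric.ball 0 1) := by
    rw [closure_ball _ one_ne_zero]; exact Metric.sphere_subset_closedBall
  have hP : ContinuousOn (fun w => (poissonKernel 0 z w : ℂ)) (Metric.sphere 0 1) :=
    Complex.continuous_ofReal.comp_continuousOn (continuousOn_poissonKernel_zero hz)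
  have hΦ := hG.dslope_unit_ball hz
  have h1 : Real.circleAverage (fun w => (poissonKernel 0 z w : ℂ) * dslope G z w) 0 1
      = deriv G z := by
    have := hΦ.circleAverage_poissonKernel_smul hzb
    rwa [dslope_same] at this
  have hk : DiffContOnCl ℂ (fun w => (1 - conj z * w)⁻¹ * G w) (Metric.ball 0 1) := by
    simpa [smul_eq_mul] using (diffContOnCl_inv_one_sub hz).smul hG
  have h2 : Real.circleAverage (fun w => (poissonKernel 0 z w : ℂ) *
      ((1 - conj z * w)⁻¹ * G w)) 0 1 = (1 - conj z * z)⁻¹ * G z :=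
    hk.circleAverage_poissonKernel_smul hzb
  have h3 := circleAverage_poissonKernel_mul_inv_sub hz
  have i1 : CircleIntegrable (fun w => (poissonKernel 0 z w : ℂ) * dslope G z w) 0 1 :=
    (hP.mul (hΦ.continuousOn.mono hs)).circleIntegrable zero_le_one
  have i2 : CircleIntegrable (fun w => conj z •
      ((poissonKernel 0 z w : ℂ) * ((1 - conj z * w)⁻¹ * G w))) 0 1 :=
    ((hP.mul (hk.continuousOn.mono hs)).const_smul (conj z)).circleIntegrable zero_le_one
  have i3 : CircleIntegrable (fun w => G z • ((poissonKernel 0 z w : ℂ) * (w - z)⁻¹)) 0 1 := by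
    refine ((hP.mul ?_).const_smul (G z)).circleIntegrable zero_le_one
    exact ContinuousOn.inv₀ (by fun_prop) fun w hw => sub_ne_zero_of_norm hz (by simpa using hw)
  -- Expand `dslope G z w = (G w - G z)/(w - z)`. The added `G z` term and the subtracted `z̄ G / (1
  -- - z̄ w)` term both average to `z̄ G(z) / (1 - |z|²)`, so `G z` drops out.
  have tot : Real.circleAverage (fun w => ((poissonKernel 0 z w : ℂ) * dslope G z w
      + G z • ((poissonKernel 0 z w : ℂ) * (w - z)⁻¹))
      - conj z • ((poissonKernel 0 z w : ℂ) * ((1 - conj z * w)⁻¹ * G w))) 0 1 = deriv G z := by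
    have i13 : CircleIntegrable (fun w => (poissonKernel 0 z w : ℂ) * dslope G z w
        + G z • ((poissonKernel 0 z w : ℂ) * (w - z)⁻¹)) 0 1 := i1.add i3
    rw [Real.circleAverage_fun_sub i13 i2, Real.circleAverage_fun_add i1 i3,
      Real.circleAverage_fun_smul, Real.circleAverage_fun_smul, h1, h2, h3]
    simp only [smul_eq_mul]; ring
  rw [← tot]
  apply Real.circleAverage_congr_sphere
  intro w hw
  have hw1 : ‖w‖ = 1 := by simpa using hw
  have hne := sub_ne_zero_of_norm hz hw1
  have hd : dslope G z w = (w - z)⁻¹ * (G w - G z) := by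
    rw [dslope_of_ne _ (sub_ne_zero.1 hne), slope_def_module, smul_eq_mul]
  simp only [hd, smul_eq_mul]
  ring

/-- Both fractions in the derivative formula have modulus at most `1/|w - z|`, because `|1 - z̄ w| =
|w - z|` on the circle. -/
theorem norm_deriv_le_circleAverage {G : ℂ → ℂ}
    (hG : DiffContOnCl ℂ G (Metric.ball 0 1)) {z : ℂ} (hz : ‖z‖ < 1) :
    ‖deriv G z‖ ≤ Real.circleAverage
      (fun w => poissonKernel 0 z w * (‖G w‖ * (2 / ‖w - z‖))) 0 1 := by
  have hs : Metric.sphere (0 : ℂ) 1 ⊆ closure (Metric.ball 0 1) := by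
    rw [closure_ball _ one_ne_zero]; exact Metric.sphere_subset_closedBall
  have hP := continuousOn_poissonKernel_zero hz
  have hP' : ContinuousOn (fun w => (poissonKernel 0 z w : ℂ)) (Metric.sphere 0 1) :=
    Complex.continuous_ofReal.comp_continuousOn hP
  have hGc := hG.continuousOn.mono hs
  have hk := (diffContOnCl_inv_one_sub hz).continuousOn.mono hs
  have hi : ContinuousOn (fun w : ℂ => (w - z)⁻¹) (Metric.sphere 0 1) :=
    ContinuousOn.inv₀ (by fun_prop) fun w hw => sub_ne_zero_of_norm hz (by simpa using hw)
  rw [← circleAverage_poissonKernel_eq_deriv hG hz]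
  refine norm_circleAverage_le.trans (Real.circleAverage_mono ?_ ?_ ?_)
  · exact (hP'.mul (hGc.mul (hi.sub (continuousOn_const.mul hk)))).norm.circleIntegrable
      zero_le_one
  · refine (hP.mul (hGc.norm.mul ?_)).circleIntegrable zero_le_one
    refine ContinuousOn.div (by fun_prop) (by fun_prop) fun w hw => ?_
    exact norm_ne_zero_iff.2 (sub_ne_zero_of_norm hz (by simpa using hw))
  · intro w hw
    have hw1 : ‖w‖ = 1 := by simpa using hw
    rw [norm_mul, norm_mul, Complex.norm_real, Real.norm_of_nonneg (poissonKernel_zero_nonneg hz hw1)]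
    have hP0 := poissonKernel_zero_nonneg hz hw1
    gcongr
    refine (norm_sub_le _ _).trans ?_
    rw [norm_mul, norm_inv, norm_inv, norm_one_sub_conj_mul hw1, RCLike.norm_conj, div_eq_mul_inv]
    nlinarith [inv_nonneg.2 (norm_nonneg (w - z))]

/-- If `G` vanishes to first order at `ζ` along the unit circle, then its derivative tends to `0`
non-tangentially at `ζ`. -/
theorem tendsto_deriv_of_isLittleO {G : ℂ → ℂ} (hG : DiffContOnCl ℂ G (Metric.ball 0 1))
    {ζ : ℂ} (hζ : ‖ζ‖ = 1) {L : ℝ} (hL : ∀ w, ‖G w‖ ≤ L * ‖w - ζ‖)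
    (ho : G =o[𝓝[Metric.sphere 0 1] ζ] fun w => w - ζ) :
    HasNontangentialLimit (deriv G) ζ 0 := by
  intro M
  rw [Metric.tendsto_nhds]
  intro ε hε
  have hL0 : 0 ≤ L := by
    have := (norm_nonneg _).trans (hL (ζ + 1))
    simpa using this
  rcases le_or_gt M 0 with hM | hM
  · filter_upwards [self_mem_nhdsWithin] with z hz
    have := (norm_nonneg _).trans_lt hz.2
    nlinarith [hz.1]
  obtain ⟨δ, hδ, hδG⟩ := Metric.mem_nhdsWithin_iff.1
    (ho.def (c := ε / (4 * (1 + M))) (by positivity))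
  -- Away from `ζ` one has `|w - z| ≥ δ/2`, so the integrand is at most `(1 - |z|²) C`, which
  -- vanishes as `z → ζ`. Near `ζ` it is at most `(ε/2)` times the Poisson kernel, whose average is
  -- `1`.
  set C : ℝ := 2 * L * (1 + M) / (δ / 2) ^ 2 with hC
  have hC0 : 0 ≤ C := by positivity
  have ht : Tendsto (fun z : ℂ => ε / 2 + (1 - ‖z‖ ^ 2) * C) (𝓝 ζ) (𝓝 (ε / 2)) := by
    have : Continuous fun z : ℂ => ε / 2 + (1 - ‖z‖ ^ 2) * C := by fun_prop
    simpa [hζ] using this.tendsto ζ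
  filter_upwards [self_mem_nhdsWithin,
    nhdsWithin_le_nhds (Metric.ball_mem_nhds ζ (half_pos hδ)),
    nhdsWithin_le_nhds (ht.eventually_lt_const (half_lt_self hε))] with z hzS hzδ hzε
  have hz : ‖z‖ < 1 := hzS.1
  have hz2 : 0 ≤ 1 - ‖z‖ ^ 2 := by nlinarith [norm_nonneg z]
  rw [dist_zero_right]
  refine (norm_deriv_le_circleAverage hG hz).trans_lt (lt_of_le_of_lt ?_ hzε)
  have hs : Metric.sphere (0 : ℂ) 1 ⊆ closure (Metric.ball 0 1) := by
    rw [closure_ball _ one_ne_zero]; exact Metric.sphere_subset_closedBall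
  have hP := continuousOn_poissonKernel_zero hz
  have iP : CircleIntegrable (fun w => (ε / 2) • poissonKernel 0 z w) 0 1 :=
    (hP.const_smul (ε / 2)).circleIntegrable zero_le_one
  have ic : CircleIntegrable (fun _ : ℂ => (1 - ‖z‖ ^ 2) * C) 0 1 :=
    continuousOn_const.circleIntegrable zero_le_one
  have hsum : Real.circleAverage
      (fun w => (ε / 2) • poissonKernel 0 z w + (1 - ‖z‖ ^ 2) * C) 0 1
      = ε / 2 + (1 - ‖z‖ ^ 2) * C := by
    rw [Real.circleAverage_fun_add iP ic, Real.circleAverage_fun_smul,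
      Real.circleAverage_const, circleAverage_poissonKernel_zero hz]
    simp
  rw [← hsum]
  refine Real.circleAverage_mono ?_ (iP.add ic) ?_
  · refine (hP.mul ((hG.continuousOn.mono hs).norm.mul ?_)).circleIntegrable zero_le_one
    refine ContinuousOn.div (by fun_prop) (by fun_prop) fun w hw => ?_
    exact norm_ne_zero_iff.2 (sub_ne_zero_of_norm hz (by simpa using hw))
  intro w hw
  rw [abs_one] at hw
  have hw1 : ‖w‖ = 1 := by simpa using hw
  have hP0 := poissonKernel_zero_nonneg hz hw1
  have hpos : 0 < ‖w - z‖ := norm_pos_iff.2 (sub_ne_zero_of_norm hz hw1)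
  -- The only use of the Stolz angle: `|z - ζ| < M (1 - |z|) ≤ M |w - z|`. It lets a bound by `|w -
  -- ζ|` absorb the factor `1/|w - z|`.
  have hwζ : ‖w - ζ‖ ≤ (1 + M) * ‖w - z‖ := by
    have h1 : 1 - ‖z‖ ≤ ‖w - z‖ := by
      have := norm_sub_norm_le w z
      rwa [hw1] at this
    have h2 : ‖w - ζ‖ ≤ ‖w - z‖ + ‖z - ζ‖ := norm_sub_le_norm_sub_add_norm_sub w z ζ
    nlinarith [hzS.2]
  have hmul : ∀ η : ℝ, 0 ≤ η → ‖G w‖ ≤ η * ‖w - ζ‖ →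
      ‖G w‖ * (2 / ‖w - z‖) ≤ 2 * η * (1 + M) := by
    intro η hη h
    rw [← mul_div_assoc, div_le_iff₀ hpos]
    nlinarith
  by_cases hwδ : ‖w - ζ‖ < δ
  · have h1 := hmul (ε / (4 * (1 + M))) (by positivity)
      (hδG ⟨by simpa [dist_eq_norm] using hwδ, hw⟩)
    have h2 : 2 * (ε / (4 * (1 + M))) * (1 + M) = ε / 2 := by field_simp; norm_num
    rw [h2] at h1
    have h3 := mul_le_mul_of_nonneg_left h1 hP0
    have h4 := mul_nonneg hz2 hC0
    simp only [smul_eq_mul]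
    linarith
  · have h1 := hmul L hL0 (hL w)
    have h5 : δ / 2 ≤ ‖w - z‖ := by
      have h2 : ‖w - ζ‖ ≤ ‖w - z‖ + ‖z - ζ‖ := norm_sub_le_norm_sub_add_norm_sub w z ζ
      have h3 : ‖z - ζ‖ < δ / 2 := by simpa [dist_eq_norm] using hzδ
      linarith
    have h6 : poissonKernel 0 z w ≤ (1 - ‖z‖ ^ 2) / (δ / 2) ^ 2 := by
      rw [poissonKernel_zero_of_norm hw1]
      gcongr
    have h7 : poissonKernel 0 z w * (‖G w‖ * (2 / ‖w - z‖))
        ≤ (1 - ‖z‖ ^ 2) / (δ / 2) ^ 2 * (2 * L * (1 + M)) := by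
      gcongr
    have h8 : (1 - ‖z‖ ^ 2) / (δ / 2) ^ 2 * (2 * L * (1 + M)) = (1 - ‖z‖ ^ 2) * C := by
      rw [hC]; ring
    have h9 : 0 ≤ (ε / 2) • poissonKernel 0 z w := by positivity
    linarith

/-! ### Fatou's theorem on boundary values -/

theorem HasNontangentialLimit.congr {f g : ℂ → ℂ} {ζ w : ℂ} (h : HasNontangentialLimit f ζ w)
    (hfg : Set.EqOn f g (Metric.ball 0 1)) : HasNontangentialLimit g ζ w := by
  intro M
  refine (h M).congr' ?_
  filter_upwards [self_mem_nhdsWithin] with z hz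
  exact hfg (by simpa using hz.1)

/-- The angle `ψ w = θ + arg (w / ζ)` inverts `t ↦ e^{it}` on the circle and satisfies `ψ w - θ =
O(w - ζ)`, so the little-o in `t` transfers to one in `w`. -/
theorem isLittleO_sphere_of_hasDerivAt {G : ℂ → ℂ} {θ : ℝ} (h0 : G (exp (θ * I)) = 0)
    (hd : HasDerivAt (fun t : ℝ => G (exp (t * I))) 0 θ) :
    G =o[𝓝[Metric.sphere 0 1] (exp (θ * I))] fun w => w - exp (θ * I) := by
  set ζ := exp (θ * I) with hζ
  have hζ0 : ζ ≠ 0 := exp_ne_zero _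
  set ψ : ℂ → ℝ := fun w => θ + (w / ζ).arg with hψ
  have hlog : HasDerivAt (fun w : ℂ => log (w / ζ)) (1 / ζ) ζ := by
    have h1 : HasDerivAt (fun w : ℂ => w / ζ) (1 / ζ) ζ := (hasDerivAt_id ζ).div_const ζ
    have h2 := h1.clog (by rw [div_self hζ0]; exact one_mem_slitPlane)
    rwa [div_self hζ0, div_one] at h2
  have hO : (fun w => ψ w - θ) =O[𝓝 ζ] fun w => w - ζ := by
    have h1 := hlog.isBigO_sub
    refine Asymptotics.IsBigO.trans (Asymptotics.IsBigO.of_bound 1 ?_) h1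
    refine Eventually.of_forall fun w => ?_
    have h2 := abs_im_le_norm (log (w / ζ))
    simpa [hψ, div_self hζ0, log_im] using h2
  have hψt : Tendsto ψ (𝓝 ζ) (𝓝 θ) := by
    have h1 : Tendsto (fun w : ℂ => w - ζ) (𝓝 ζ) (𝓝 0) := by
      have : Continuous fun w : ℂ => w - ζ := by fun_prop
      simpa using this.tendsto ζ
    have h2 := (hO.trans_tendsto h1).add_const θ
    simpa using h2
  have ho := hd.isLittleO
  simp only [sub_zero, smul_zero] at ho
  have h3 := (ho.comp_tendsto (hψt.mono_left nhdsWithin_le_nhds :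
    Tendsto ψ (𝓝[Metric.sphere 0 1] ζ) (𝓝 θ))).trans_isBigO (hO.mono nhdsWithin_le_nhds)
  refine h3.congr' ?_ (EventuallyEq.rfl)
  filter_upwards [self_mem_nhdsWithin] with w hw
  have hw1 : ‖w‖ = 1 := by simpa using hw
  have hn : ‖w / ζ‖ = 1 := by rw [norm_div, hw1, hζ, norm_exp_ofReal_mul_I, div_one]
  have h4 := norm_mul_exp_arg_mul_I (w / ζ)
  rw [hn, ofReal_one, one_mul] at h4
  have : exp ((ψ w : ℂ) * I) = w := by
    rw [hψ]; push_cast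
    rw [add_mul, exp_add, h4, ← hζ]
    field_simp
  simp only [Function.comp_apply, this, ← hζ, h0, sub_zero]

/-- Fatou's theorem: a bounded analytic function on the disk has non-tangential limits almost
everywhere on the circle. -/
theorem ae_exists_hasNontangentialLimit {f : ℂ → ℂ} (hf : DifferentiableOn ℂ f (Metric.ball 0 1))
    {K : NNReal} (hK : ∀ z ∈ Metric.ball (0 : ℂ) 1, ‖f z‖ ≤ K) :
    ∀ᵐ θ : ℝ, ∃ w, HasNontangentialLimit f (exp (θ * I)) w := by
  obtain ⟨F₀, hF₀⟩ := hf.isExactOn_ball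
  have hlip : LipschitzOnWith K F₀ (Metric.ball 0 1) :=
    (convex_ball (0 : ℂ) 1).lipschitzOnWith_of_nnnorm_hasDerivWithin_le
      (fun z hz => (hF₀ z hz).hasDerivWithinAt) (fun z hz => hK z hz)
  -- The primitive is extended to a Lipschitz map of the whole plane, at the price of a larger
  -- constant, so that it has values on the circle.
  obtain ⟨F, hFl, hFe⟩ := hlip.extend_finite_dimension
  set K' := lipschitzExtensionConstant ℂ * K
  have hFd : ∀ z ∈ Metric.ball (0 : ℂ) 1, HasDerivAt F (f z) z := fun z hz =>
    (hF₀ z hz).congr_of_eventuallyEq <|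
      (hFe.symm.eventuallyEq_of_mem (Metric.isOpen_ball.mem_nhds hz))
  have hFcl : DiffContOnCl ℂ F (Metric.ball 0 1) :=
    ⟨fun z hz => (hFd z hz).differentiableAt.differentiableWithinAt, hFl.continuous.continuousOn⟩
  have hexp : LipschitzWith 1 fun t : ℝ => exp (t * I) := by
    refine lipschitzWith_of_nnnorm_deriv_le (𝕜 := ℝ) ?_ ?_
    · fun_prop
    · intro t
      have h : HasDerivAt (fun t : ℝ => exp (t * I)) (exp (t * I) * (1 * I)) t :=
        ((hasDerivAt_id t).ofReal_comp.mul_const I).cexp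
      rw [h.deriv, ← NNReal.coe_le_coe]
      simp
  have hcomp := (hFl.comp hexp).ae_differentiableAt_real
  filter_upwards [hcomp] with θ hθ
  set ζ := exp (θ * I) with hζ
  have hζ1 : ‖ζ‖ = 1 := norm_exp_ofReal_mul_I θ
  have hζ0 : ζ ≠ 0 := exp_ne_zero _
  set d := deriv (F ∘ fun t : ℝ => exp (t * I)) θ
  -- Since `e^{it}` has derivative `ζ I` at `θ`, this quotient is the tangential complex derivative
  -- of `F` at `ζ`. Subtracting the affine map of slope `a` leaves `G` with `G' = f - a` in the disk
  -- and `G = o(w - ζ)` on the circle.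
  set a := d / (ζ * I)
  refine ⟨a, ?_⟩
  set G : ℂ → ℂ := fun w => F w - F ζ - a * (w - ζ) with hG
  have hGd : ∀ z ∈ Metric.ball (0 : ℂ) 1, HasDerivAt G (f z - a) z := fun z hz => by
    have := ((hFd z hz).sub_const (F ζ)).sub (((hasDerivAt_id z).sub_const ζ).const_mul a)
    rw [mul_one] at this
    exact this
  have hGcl : DiffContOnCl ℂ G (Metric.ball 0 1) := by
    refine ⟨fun z hz => (hGd z hz).differentiableAt.differentiableWithinAt, ?_⟩
    have := hFl.continuous
    exact Continuous.continuousOn (by fun_prop)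
  have hGL : ∀ w, ‖G w‖ ≤ (K' + ‖a‖) * ‖w - ζ‖ := by
    intro w
    have h1 : ‖F w - F ζ‖ ≤ K' * ‖w - ζ‖ := by
      simpa [dist_eq_norm] using hFl.dist_le_mul w ζ
    refine (norm_sub_le _ _).trans ?_
    rw [norm_mul, add_mul]
    gcongr
  have hGder : HasDerivAt (fun t : ℝ => G (exp (t * I))) 0 θ := by
    have h1 : HasDerivAt (fun t : ℝ => exp (t * I)) (exp (θ * I) * (1 * I)) θ :=
      ((hasDerivAt_id θ).ofReal_comp.mul_const I).cexp
    have h2 := (hθ.hasDerivAt.sub_const (F ζ)).sub ((h1.sub_const ζ).const_mul a)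
    have e : d - a * (exp (θ * I) * (1 * I)) = 0 := by
      rw [← hζ, one_mul, div_mul_cancel₀ _ (mul_ne_zero hζ0 I_ne_zero), sub_self]
    rw [← e]
    exact h2
  have hlim := tendsto_deriv_of_isLittleO hGcl hζ1 hGL
    (isLittleO_sphere_of_hasDerivAt (by simp [hG, hζ]) hGder)
  have hlim' : HasNontangentialLimit (fun z => deriv G z + a) ζ a := by
    intro M
    simpa using (hlim M).add_const a
  refine hlim'.congr fun z hz => ?_
  simp [(hGd z hz).deriv]

/-! ### Kernels of `H(b)` -/

theorem inner_reproducingKernel {X : Type*} {H : Type*} [NormedAddCommGroup H]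
    [InnerProductSpace ℂ H] [CompleteSpace H] [RKHS ℂ H X ℂ] (x : X) (f : H) :
    inner ℂ (reproducingKernel H x) f = f x := by
  simp [reproducingKernel]

theorem reproducingKernel_deBrangesRovnyak_apply (b : HInftyUnitBall) (lam z : 𝔻) :
    reproducingKernel (DeBrangesRovnyak b) lam z = dbrKernelFun b lam z := by
  rw [reproducingKernel, RKHS.kerFun_apply, RKHS.OfKernel.kernel_ofKernel]
  simp [dbrKernel]

theorem norm_sq_reproducingKernel_deBrangesRovnyak (b : HInftyUnitBall) (lam : 𝔻) :
    ‖reproducingKernel (DeBrangesRovnyak b) lam‖ ^ 2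
      = (1 - ‖b.toFun lam‖ ^ 2) / (1 - ‖(lam : ℂ)‖ ^ 2) := by
  have h := inner_self_eq_norm_sq_to_K (𝕜 := ℂ) (reproducingKernel (DeBrangesRovnyak b) lam)
  rw [inner_reproducingKernel, reproducingKernel_deBrangesRovnyak_apply, dbrKernelFun,
    conj_mul', conj_mul'] at h
  apply Complex.ofReal_injective
  push_cast
  exact h.symm

theorem norm_sq_dbrKernelFun_le (b : HInftyUnitBall) (lam z : 𝔻) :
    ‖dbrKernelFun b lam z‖ ^ 2 ≤ 4 / ‖1 - conj (lam : ℂ) * z‖ ^ 2 := by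
  have hb : ∀ z : 𝔻, ‖b.toFun z‖ ≤ 1 := fun z => b.norm_le_one z (by simpa using z.norm_lt_one)
  rw [dbrKernelFun, norm_div, div_pow]
  gcongr
  have h : ‖1 - conj (b.toFun lam) * b.toFun z‖ ≤ 2 := by
    refine (norm_sub_le _ _).trans ?_
    rw [norm_one, norm_mul, RCLike.norm_conj]
    nlinarith [hb lam, hb z, norm_nonneg (b.toFun lam), norm_nonneg (b.toFun z)]
  nlinarith [norm_nonneg (1 - conj (b.toFun lam) * b.toFun z)]

/-- A bounded analytic function attaining modulus `1` inside the disk is constant, hence inner. -/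
theorem HInftyUnitBall.isInner_of_norm_eq_one (b : HInftyUnitBall) {z₀ : ℂ}
    (hz₀ : z₀ ∈ Metric.ball (0 : ℂ) 1) (h : ‖b.toFun z₀‖ = 1) : b.IsInner := by
  have hE : Set.EqOn b.toFun (Function.const ℂ (b.toFun z₀)) (Metric.ball 0 1) :=
    Complex.eqOn_of_isPreconnected_of_isMaxOn_norm (convex_ball (0 : ℂ) 1).isPreconnected
      Metric.isOpen_ball b.differentiableOn hz₀ fun z hz => by
        simpa [h] using b.norm_le_one z hz
  refine Eventually.of_forall fun θ => ⟨b.toFun z₀, ?_, h⟩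
  exact HasNontangentialLimit.congr (f := fun _ => b.toFun z₀) (fun _ => tendsto_const_nhds)
    fun z hz => (hE hz).symm

/-! ### Circle means of `1 - |b|²` -/

theorem lintegral_poissonKernel {y : ℂ} (hy : ‖y‖ < 1) (t : ℝ) :
    ∫⁻ θ in Set.Ioc t (t + 2 * Real.pi), ENNReal.ofReal (poissonKernel 0 y (exp (θ * I)))
      = ENNReal.ofReal (2 * Real.pi) := by
  have hcm : ∀ θ : ℝ, circleMap 0 1 θ = exp (θ * I) := fun θ => by simp [circleMap]
  have hs : ∀ θ : ℝ, exp (θ * I) ∈ Metric.sphere (0 : ℂ) 1 := fun θ => by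
    simp [norm_exp_ofReal_mul_I]
  have hc : Continuous fun θ : ℝ => poissonKernel 0 y (exp (θ * I)) :=
    (continuousOn_poissonKernel_zero hy).comp_continuous (by fun_prop) hs
  have hper : Function.Periodic (fun θ : ℝ => poissonKernel 0 y (exp (θ * I))) (2 * Real.pi) := by
    intro θ
    have := periodic_circleMap 0 1 θ
    rw [hcm, hcm] at this
    simp only [this]
  have hI : ∫ θ in t..t + 2 * Real.pi, poissonKernel 0 y (exp (θ * I)) = 2 * Real.pi := by
    rw [hper.intervalIntegral_add_eq t 0, zero_add]
    have h := circleAverage_poissonKernel_zero hy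
    rw [Real.circleAverage_def, smul_eq_mul, inv_mul_eq_iff_eq_mul₀ (by positivity), mul_one] at h
    simpa only [hcm] using h
  rw [← ofReal_integral_eq_lintegral_ofReal, ← intervalIntegral.integral_of_le, hI]
  · linarith [Real.pi_pos]
  · exact (hc.intervalIntegrable t (t + 2 * Real.pi)).1
  · exact Eventually.of_forall fun θ => poissonKernel_zero_nonneg hy (norm_exp_ofReal_mul_I θ)

theorem ae_of_ae_restrict_Ioc_add {p : ℝ → Prop} {T : ℝ} (hT : 0 < T)
    (h : ∀ t, ∀ᵐ θ ∂volume.restrict (Set.Ioc t (t + T)), p θ) : ∀ᵐ θ : ℝ, p θ := by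
  rw [← Measure.restrict_univ (μ := volume), ← iUnion_Ioc_zsmul hT, ae_restrict_iUnion_iff]
  intro n
  have := h (n • T)
  rwa [add_smul, one_smul]

/-- If `1 - |b|²` tends to zero in mean over circles of radius tending to `1`, then `b` is
inner. -/
theorem HInftyUnitBall.isInner_of_tendsto_lintegral (b : HInftyUnitBall) {r : ℕ → ℝ}
    (hr : ∀ n, r n ∈ Set.Ioo (0 : ℝ) 1) (hr1 : Tendsto r atTop (𝓝 1))
    (h : ∀ t, Tendsto (fun n => ∫⁻ θ in Set.Ioc t (t + 2 * Real.pi),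
      ENNReal.ofReal (1 - ‖b.toFun (r n * exp (θ * I))‖ ^ 2)) atTop (𝓝 0)) : b.IsInner := by
  have hmem : ∀ n (θ : ℝ), (r n * exp (θ * I) : ℂ) ∈ Metric.ball (0 : ℂ) 1 := fun n θ => by
    have := hr n
    simp [norm_exp_ofReal_mul_I, abs_of_pos this.1, this.2]
  have hmeas : ∀ n, Measurable fun θ : ℝ =>
      ENNReal.ofReal (1 - ‖b.toFun (r n * exp (θ * I))‖ ^ 2) := by
    intro n
    have : Continuous fun θ : ℝ => b.toFun (r n * exp (θ * I)) :=
      b.differentiableOn.continuousOn.comp_continuous (by fun_prop) (hmem n)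
    exact (by fun_prop : Continuous fun θ : ℝ =>
      1 - ‖b.toFun (r n * exp (θ * I))‖ ^ 2).measurable.ennreal_ofReal
  have hlim : ∀ᵐ θ : ℝ,
      liminf (fun n => ENNReal.ofReal (1 - ‖b.toFun (r n * exp (θ * I))‖ ^ 2)) atTop = 0 := by
    -- Fatou's lemma on each period: the integral of the liminf is at most the liminf of the
    -- integrals, which is `0`.
    refine ae_of_ae_restrict_Ioc_add Real.two_pi_pos fun t => ?_
    have h1 := lintegral_liminf_le (μ := volume.restrict (Set.Ioc t (t + 2 * Real.pi)))
      (u := atTop) hmeas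
    rw [(h t).liminf_eq, nonpos_iff_eq_zero, lintegral_eq_zero_iff (Measurable.liminf hmeas)] at h1
    exact h1
  filter_upwards [hlim, ae_exists_hasNontangentialLimit b.differentiableOn (K := 1)
    (fun z hz => by simpa using b.norm_le_one z hz)] with θ hθ ⟨w, hw⟩
  refine ⟨w, hw, ?_⟩
  -- The radius lies in the Stolz angle of aperture `2`, as `|rζ - ζ| = 1 - r < 2 (1 - r)`. The
  -- liminf along it is therefore `1 - |w|²`.
  have hrad : Tendsto (fun n => (r n * exp (θ * I) : ℂ)) atTop
      (𝓝[stolzAngle (exp (θ * I)) 2] (exp (θ * I))) := by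
    refine tendsto_nhdsWithin_iff.2 ⟨?_, Eventually.of_forall fun n => ?_⟩
    · have := ((continuous_ofReal.tendsto 1).comp hr1).mul_const (exp (θ * I))
      simpa using this
    · have h2 := hr n
      have e : (r n * exp (θ * I) : ℂ) - exp (θ * I) = ((r n - 1 : ℝ) : ℂ) * exp (θ * I) := by
        push_cast; ring
      refine ⟨by simpa using hmem n θ, ?_⟩
      rw [e, norm_mul, norm_mul, norm_exp_ofReal_mul_I, Complex.norm_real, Complex.norm_real,
        Real.norm_of_nonneg h2.1.le, Real.norm_of_nonpos (by linarith [h2.2])]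
      linarith [h2.2]
  have hb := (hw 2).comp hrad
  have hle : ‖w‖ ≤ 1 := le_of_tendsto hb.norm
    (Eventually.of_forall fun n => b.norm_le_one _ (hmem n θ))
  have h3 : Tendsto (fun n => ENNReal.ofReal (1 - ‖b.toFun (r n * exp (θ * I))‖ ^ 2)) atTop
      (𝓝 (ENNReal.ofReal (1 - ‖w‖ ^ 2))) :=
    (ENNReal.continuous_ofReal.tendsto _).comp ((hb.norm.pow 2).const_sub 1)
  rw [h3.liminf_eq, ENNReal.ofReal_eq_zero] at hθ
  nlinarith [norm_nonneg w]

/-- The mean over the circle of radius `r` of `1 - |b|²` is controlled by the frame sums of the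
reproducing kernels. -/
theorem HInftyUnitBall.lintegral_le_of_frame (b : HInftyUnitBall) {ι : Type*} [Countable ι]
    (x : ι → 𝔻) {c : ℝ} (hc : 0 < c)
    (h : ∀ f : DeBrangesRovnyak b,
      Summable (fun i => (‖reproducingKernel (DeBrangesRovnyak b) (x i)‖ ^ 2)⁻¹ * ‖f (x i)‖ ^ 2) ∧
      c * ‖f‖ ^ 2 ≤
        ∑' i, (‖reproducingKernel (DeBrangesRovnyak b) (x i)‖ ^ 2)⁻¹ * ‖f (x i)‖ ^ 2)
    {r : ℝ} (hr : r ∈ Set.Ioo (0 : ℝ) 1) (t : ℝ) :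
    ∫⁻ θ in Set.Ioc t (t + 2 * Real.pi), ENNReal.ofReal (1 - ‖b.toFun (r * exp (θ * I))‖ ^ 2)
      ≤ ∑' i, ENNReal.ofReal (c⁻¹ * ((‖reproducingKernel (DeBrangesRovnyak b) (x i)‖ ^ 2)⁻¹ *
        (4 * ((1 - r ^ 2) / (1 - r ^ 2 * ‖(x i : ℂ)‖ ^ 2))))) * ENNReal.ofReal (2 * Real.pi) := by
  set k := reproducingKernel (DeBrangesRovnyak b)
  have hr2 : 0 < 1 - r ^ 2 := by nlinarith [hr.1, hr.2]
  have hxn : ∀ i, ‖(r * x i : ℂ)‖ = r * ‖(x i : ℂ)‖ := fun i => by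
    rw [norm_mul, Complex.norm_real, Real.norm_of_nonneg hr.1.le]
  have hx : ∀ i, ‖(r * x i : ℂ)‖ < 1 := fun i => by
    rw [hxn]
    nlinarith [hr.1, hr.2, norm_nonneg (x i : ℂ), (x i).norm_lt_one]
  have hx2 : ∀ i, 0 < 1 - r ^ 2 * ‖(x i : ℂ)‖ ^ 2 := fun i => by
    have := hx i
    rw [hxn] at this
    have h0 : 0 ≤ r * ‖(x i : ℂ)‖ := mul_nonneg hr.1.le (norm_nonneg _)
    nlinarith
  set a : ι → ℝ := fun i => c⁻¹ * ((‖k (x i)‖ ^ 2)⁻¹ *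
    (4 * ((1 - r ^ 2) / (1 - r ^ 2 * ‖(x i : ℂ)‖ ^ 2)))) with ha
  have ha0 : ∀ i, 0 ≤ a i := fun i => by
    have := hx2 i
    positivity
  have hpt : ∀ θ : ℝ, ENNReal.ofReal (1 - ‖b.toFun (r * exp (θ * I))‖ ^ 2)
      ≤ ∑' i, ENNReal.ofReal (a i) * ENNReal.ofReal (poissonKernel 0 (r * x i) (exp (θ * I))) := by
    intro θ
    have hζ : ‖exp (θ * I)‖ = 1 := norm_exp_ofReal_mul_I θ
    have hln : ‖(r * exp (θ * I) : ℂ)‖ = r := by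
      rw [norm_mul, hζ, Complex.norm_real, Real.norm_of_nonneg hr.1.le, mul_one]
    set lam : 𝔻 := Complex.UnitDisc.mk (r * exp (θ * I)) (by rw [hln]; exact hr.2) with hlam
    have hlc : (lam : ℂ) = r * exp (θ * I) := Complex.UnitDisc.coe_mk _ _
    obtain ⟨hs, hle⟩ := h (k lam)
    rw [norm_sq_reproducingKernel_deBrangesRovnyak, hlc, hln] at hle
    have h1 : 1 - ‖b.toFun (r * exp (θ * I))‖ ^ 2
        ≤ ∑' i, (c⁻¹ * (1 - r ^ 2)) * ((‖k (x i)‖ ^ 2)⁻¹ * ‖k lam (x i)‖ ^ 2) := by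
      rw [tsum_mul_left]
      rw [mul_div_assoc', div_le_iff₀ hr2] at hle
      rw [mul_assoc, inv_mul_eq_div, le_div_iff₀ hc]
      linarith
    refine (ENNReal.ofReal_le_ofReal h1).trans ?_
    rw [ENNReal.ofReal_tsum_of_nonneg (fun i => by positivity) (hs.mul_left _)]
    refine ENNReal.tsum_le_tsum fun i => ?_
    rw [← ENNReal.ofReal_mul (ha0 i)]
    refine ENNReal.ofReal_le_ofReal ?_
    -- Conjugating inside the modulus moves the dilation `r` from `lam` to `x i`: `|1 - r ζ̄ x| = |ζ
    -- - r x|`. This exposes the Poisson kernel at the interior point `r x`.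
    have h2 : ‖k lam (x i)‖ ^ 2 ≤ 4 / ‖exp (θ * I) - r * x i‖ ^ 2 := by
      refine (congrArg (‖·‖ ^ 2) (reproducingKernel_deBrangesRovnyak_apply b lam (x i))).le.trans
        ((norm_sq_dbrKernelFun_le b lam (x i)).trans_eq ?_)
      rw [← norm_one_sub_conj_mul hζ, ← RCLike.norm_conj (1 - conj (lam : ℂ) * x i), hlc]
      congr 3
      simp
      ring
    rw [poissonKernel_zero_of_norm hζ, hxn, mul_pow]
    have h3 := hx2 i
    calc c⁻¹ * (1 - r ^ 2) * ((‖k (x i)‖ ^ 2)⁻¹ * ‖k lam (x i)‖ ^ 2)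
        ≤ c⁻¹ * (1 - r ^ 2) * ((‖k (x i)‖ ^ 2)⁻¹ * (4 / ‖exp (θ * I) - r * x i‖ ^ 2)) := by
          gcongr
      _ = _ := by
          simp only [ha]
          field_simp
  refine (lintegral_mono hpt).trans_eq ?_
  have hpm : ∀ i, Measurable fun θ : ℝ =>
      ENNReal.ofReal (poissonKernel 0 (r * x i) (exp (θ * I))) := fun i =>
    (((continuousOn_poissonKernel_zero (hx i)).comp_continuous (by fun_prop)
      fun θ => by simp [norm_exp_ofReal_mul_I] : Continuous fun θ : ℝ =>
        poissonKernel 0 (r * x i) (exp (θ * I))).measurable).ennreal_ofReal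
  rw [lintegral_tsum fun i => ((hpm i).const_mul _).aemeasurable]
  refine tsum_congr fun i => ?_
  rw [lintegral_const_mul _ (hpm i), lintegral_poissonKernel (hx i)]

/-- If the normalized reproducing kernels at the points `x i` satisfy a lower frame bound, then
`b` is inner. -/
theorem HInftyUnitBall.isInner_of_frame (b : HInftyUnitBall) {ι : Type*} (x : ι → 𝔻) {c : ℝ}
    (hc : 0 < c)
    (h : ∀ f : DeBrangesRovnyak b,
      Summable (fun i => (‖reproducingKernel (DeBrangesRovnyak b) (x i)‖ ^ 2)⁻¹ * ‖f (x i)‖ ^ 2) ∧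
      c * ‖f‖ ^ 2 ≤
        ∑' i, (‖reproducingKernel (DeBrangesRovnyak b) (x i)‖ ^ 2)⁻¹ * ‖f (x i)‖ ^ 2) :
    b.IsInner := by
  by_cases hb : ∃ z ∈ Metric.ball (0 : ℂ) 1, ‖b.toFun z‖ = 1
  · obtain ⟨z, hz, h1⟩ := hb
    exact b.isInner_of_norm_eq_one hz h1
  push Not at hb
  have hlt : ∀ z : 𝔻, ‖b.toFun z‖ < 1 := fun z =>
    have hz : (z : ℂ) ∈ Metric.ball (0 : ℂ) 1 := by simpa using z.norm_lt_one
    lt_of_le_of_ne (b.norm_le_one z hz) (hb z hz)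
  set w : ι → ℝ := fun i => (‖reproducingKernel (DeBrangesRovnyak b) (x i)‖ ^ 2)⁻¹ with hw
  have hw0 : ∀ i, 0 < w i := fun i => by
    simp only [hw]
    rw [norm_sq_reproducingKernel_deBrangesRovnyak]
    have h1 := hlt (x i)
    have h2 := (x i).norm_lt_one
    have h3 : 0 < 1 - ‖b.toFun (x i)‖ ^ 2 := by nlinarith [norm_nonneg (b.toFun (x i))]
    have h4 : 0 < 1 - ‖(x i : ℂ)‖ ^ 2 := by nlinarith [norm_nonneg (x i : ℂ)]
    positivity
  -- Test on `k_0 = 1 - conj (b 0) * b`, whose modulus is at least `1 - |b(0)| > 0` throughout the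
  -- disk.
  have hws : Summable w := by
    have h0 := (h (reproducingKernel (DeBrangesRovnyak b) 0)).1
    have hd : 0 < 1 - ‖b.toFun (0 : 𝔻)‖ := by linarith [hlt 0]
    refine Summable.of_nonneg_of_le (fun i => (hw0 i).le) (fun i => ?_)
      (h0.mul_left (((1 - ‖b.toFun (0 : 𝔻)‖) ^ 2)⁻¹))
    rw [inv_mul_eq_div, le_div_iff₀ (by positivity)]
    refine mul_le_mul_of_nonneg_left ?_ (hw0 i).le
    rw [reproducingKernel_deBrangesRovnyak_apply, dbrKernelFun]
    have h1 : 1 - ‖b.toFun (0 : 𝔻)‖ ≤ ‖1 - conj (b.toFun (0 : 𝔻)) * b.toFun (x i)‖ := by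
      refine le_trans ?_ (norm_sub_norm_le _ _)
      rw [norm_one, norm_mul, RCLike.norm_conj]
      nlinarith [hlt (x i), norm_nonneg (b.toFun (0 : 𝔻))]
    simp only [Complex.UnitDisc.coe_zero, map_zero, zero_mul, sub_zero, div_one] at h1 hd ⊢
    gcongr
  -- A summable family of strictly positive weights has a countable index set; this permits
  -- exchanging sum and integral.
  have hcount : Countable ι := by
    have h1 := hws.countable_support
    have h2 : Function.support w = Set.univ := Set.eq_univ_of_forall fun i => (hw0 i).ne'
    rw [h2] at h1
    exact Set.countable_univ_iff.1 h1
  set r : ℕ → ℝ := fun n => 1 - 1 / ((n : ℝ) + 2) with hrdef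
  have hr : ∀ n, r n ∈ Set.Ioo (0 : ℝ) 1 := fun n => by
    have h1 : 0 < 1 / ((n : ℝ) + 2) := by positivity
    have h2 : 1 / ((n : ℝ) + 2) < 1 := by
      rw [div_lt_one (by positivity)]
      linarith [Nat.cast_nonneg (α := ℝ) n]
    exact ⟨by simp only [hrdef]; linarith, by simp only [hrdef]; linarith⟩
  have hr1 : Tendsto r atTop (𝓝 1) := by
    have h1 : Tendsto (fun n : ℕ => 1 / ((n : ℝ) + 2)) atTop (𝓝 0) :=
      tendsto_const_nhds.div_atTop (tendsto_atTop_add_const_right _ _ tendsto_natCast_atTop_atTop)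
    simpa only [sub_zero] using h1.const_sub 1
  refine b.isInner_of_tendsto_lintegral hr hr1 fun t => ?_
  set q : ℕ → ι → ℝ := fun n i =>
    c⁻¹ * (w i * (4 * ((1 - r n ^ 2) / (1 - r n ^ 2 * ‖(x i : ℂ)‖ ^ 2)))) with hq
  have hx2 : ∀ i, ‖(x i : ℂ)‖ ^ 2 < 1 := fun i => by
    nlinarith [norm_nonneg (x i : ℂ), (x i).norm_lt_one]
  have hfrac : ∀ n i, 0 ≤ (1 - r n ^ 2) / (1 - r n ^ 2 * ‖(x i : ℂ)‖ ^ 2) ∧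
      (1 - r n ^ 2) / (1 - r n ^ 2 * ‖(x i : ℂ)‖ ^ 2) ≤ 1 := fun n i => by
    have h1 : r n ^ 2 < 1 := by nlinarith [(hr n).1, (hr n).2]
    have h3 : r n ^ 2 * ‖(x i : ℂ)‖ ^ 2 ≤ r n ^ 2 :=
      mul_le_of_le_one_right (by positivity) (hx2 i).le
    have h2 : 0 < 1 - r n ^ 2 * ‖(x i : ℂ)‖ ^ 2 := by linarith
    exact ⟨div_nonneg (by linarith) h2.le, (div_le_one h2).2 (by linarith)⟩
  have hq0 : ∀ n i, 0 ≤ q n i := fun n i => by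
    have h1 := (hfrac n i).1
    have h2 := hw0 i
    positivity
  have hqle : ∀ n i, q n i ≤ c⁻¹ * (w i * (4 * 1)) := fun n i => by
    have h1 := (hfrac n i).2
    have h2 := hw0 i
    simp only [hq]
    gcongr
  have hbs : Summable fun i => c⁻¹ * (w i * (4 * 1)) := (hws.mul_right _).mul_left _
  have hqs : ∀ n, Summable (q n) := fun n => Summable.of_nonneg_of_le (hq0 n) (hqle n) hbs
  -- Each term tends to `0` because `|x i| < 1` is fixed while `r → 1`; the dominating series is `4
  -- w_i / c`.
  have hqt : Tendsto (fun n => ∑' i, q n i) atTop (𝓝 0) := by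
    have := tendsto_tsum_of_dominated_convergence (𝓕 := atTop) (f := q) (g := fun _ => (0 : ℝ)) hbs
      (fun i => ?_) (Eventually.of_forall fun n i => ?_)
    · simpa using this
    · have h1 : Tendsto (fun n => (1 - r n ^ 2) / (1 - r n ^ 2 * ‖(x i : ℂ)‖ ^ 2)) atTop
          (𝓝 ((1 - 1 ^ 2) / (1 - 1 ^ 2 * ‖(x i : ℂ)‖ ^ 2))) :=
        ((hr1.pow 2).const_sub 1).div (((hr1.pow 2).mul_const _).const_sub 1)
          (by have := hx2 i; simp only [one_pow, one_mul]; linarith)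
      have h2 := ((h1.const_mul 4).const_mul (w i)).const_mul c⁻¹
      simpa using h2
    · rw [Real.norm_of_nonneg (hq0 n i)]
      exact hqle n i
  have hup : Tendsto (fun n => ENNReal.ofReal (∑' i, q n i) * ENNReal.ofReal (2 * Real.pi))
      atTop (𝓝 0) := by
    have h1 := (ENNReal.continuous_ofReal.tendsto _).comp (hqt.mul_const (2 * Real.pi))
    rw [zero_mul, ENNReal.ofReal_zero] at h1
    refine h1.congr fun n => ?_
    exact ENNReal.ofReal_mul (tsum_nonneg (hq0 n))
  refine tendsto_of_tendsto_of_tendsto_of_le_of_le tendsto_const_nhds hup (fun _ => zero_le)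
    fun n => ?_
  refine (b.lintegral_le_of_frame x hc h (hr n) t).trans_eq ?_
  rw [ENNReal.tsum_mul_right, ENNReal.ofReal_tsum_of_nonneg (hq0 n) (hqs n)]

/-! ### Orthogonal kernel bases and conclusion -/

/-- Parseval's identity for an orthogonal basis of reproducing kernels. -/
theorem IsOrthogonalKernelBasis.hasSum_norm_sq {X : Type*} {H : Type*} [NormedAddCommGroup H]
    [InnerProductSpace ℂ H] [CompleteSpace H] [RKHS ℂ H X ℂ] {S : Set X}
    (hS : IsOrthogonalKernelBasis H S) (f : H) :
    HasSum (fun x : S => (‖reproducingKernel H (x : X)‖ ^ 2)⁻¹ * ‖f x‖ ^ 2) (‖f‖ ^ 2) := by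
  obtain ⟨hne, horth, hspan⟩ := hS
  set e : S → H := fun x => ((‖reproducingKernel H (x : X)‖ : ℂ)⁻¹) • reproducingKernel H (x : X)
    with he
  have hn : ∀ x : S, (‖reproducingKernel H (x : X)‖ : ℂ) ≠ 0 := fun x => by
    exact_mod_cast norm_ne_zero_iff.2 (hne x x.2)
  have hon : Orthonormal ℂ e := by
    refine ⟨fun x => ?_, fun x y hxy => ?_⟩
    · have := hn x
      simp only [he, norm_smul, norm_inv, Complex.norm_real, norm_norm]
      exact inv_mul_cancel₀ (by exact_mod_cast this)
    · simp only [he, inner_smul_left, inner_smul_right]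
      rw [horth x x.2 y y.2 fun h => hxy (Subtype.ext h)]
      simp
  have hsp : ⊤ ≤ (Submodule.span ℂ (Set.range e)).topologicalClosure := by
    rw [← hspan]
    refine Submodule.topologicalClosure_mono (Submodule.span_le.2 ?_)
    rintro _ ⟨x, hx, rfl⟩
    have h1 : reproducingKernel H x = (‖reproducingKernel H x‖ : ℂ) • e ⟨x, hx⟩ := by
      simp only [he, smul_smul]
      rw [mul_inv_cancel₀ (hn ⟨x, hx⟩), one_smul]
    rw [h1]
    exact Submodule.smul_mem _ _ (Submodule.subset_span ⟨_, rfl⟩)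
  have h1 := (HilbertBasis.mk hon hsp).hasSum_inner_mul_inner f f
  have h2 := Complex.reCLM.hasSum h1
  have h3 : Complex.reCLM (inner ℂ f f) = ‖f‖ ^ 2 := by
    rw [inner_self_eq_norm_sq_to_K]
    norm_cast
  rw [h3] at h2
  refine h2.congr_fun fun x => ?_
  rw [HilbertBasis.coe_mk, ← inner_conj_symm, conj_mul', ← ofReal_pow, reCLM_apply, ofReal_re]
  simp [he, inner_smul_left, inner_reproducingKernel, mul_pow]

theorem corollary4p7 (b : HInftyUnitBall) :
    ((∃ x : ℕ → Complex.UnitDisc, IsSamplingSequence (DeBrangesRovnyak b) x) → b.IsInner) ∧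
    (¬ b.IsInner → ¬ ∃ S : Set Complex.UnitDisc,
      IsOrthogonalKernelBasis (DeBrangesRovnyak b) S) := by
  refine ⟨?_, ?_⟩
  · rintro ⟨x, c, C, hc, -, h⟩
    exact b.isInner_of_frame x hc fun f => ⟨(h f).1, (h f).2.1⟩
  · rintro hb ⟨S, hS⟩
    refine hb (b.isInner_of_frame (fun x : S => (x : 𝔻)) one_pos fun f => ?_)
    have := hS.hasSum_norm_sq f
    exact ⟨this.summable, by rw [one_mul, this.tsum_eq]⟩
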